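/- Identify $\mathbb R^2$ with $\mathbb C$. For $\tau\in\mathbb C$ with $\operatorname{Im}\tau>0$ put $\nu_1=\sqrt{2\pi/\operatorname{Im}\tau}$, $\nu_2=\sqrt{2\pi/\operatorname{Im}\tau}\,\tau$, $\mathcal L_\tau=\mathbb Z\nu_1+\mathbb Z\nu_2$, and let $\langle f\rangle$ denote the average of $f$ over the cell $\{u\nu_1+v\nu_2:0\le u,v\le1\}$. Let $\hat{\mathcal L}_\tau$ be the group of characters $\chi:\mathcal L_\tau\to U(1)$. Let $J=\begin{pmatrix}0&1\\-1&0\end{pmatrix}$, $a^0(x)=-\tfrac12Jx$, $\nabla_{a}=\nabla-ia$ and $\Delta_a=\nabla_a\cdot\nabla_a$. For $\chi\in\hat{\mathcal L}_\tau$ let $\phi_\chi:\mathbb R^2\to\mathbb C$ be the solution, unique up to a constant factor of modulus one, of $$(-\Delta_{a^0}-1)\phi=0,\qquad \phi(x+s)=e^{\frac i2 s\cdot Jx}\,(-1)^{mn}\,\chi(s)\,\phi(x)\quad\text{for all } s=m\nu_1+n\nu_2,\ m,n\in\mathbb Z,$$ normalized by $\langle|\phi_\chi|^2\rangle=1$;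 write $\phi_0$ for $\phi_\chi$ with $\chi=1$. Define $$\gamma_\chi(\tau)=2\langle|\phi_0|^2|\phi_\chi|^2\rangle+\bigl|\langle\phi_0^2\,\bar\phi_\chi\,\bar\phi_{\chi^{-1}}\rangle\bigr|-\langle|\phi_0|^4\rangle,\qquad \gamma(\tau)=\inf_{\chi\in\hat{\mathcal L}_\tau}\gamma_\chi(\tau).$$ **Proposition.** (i) For all $\tau$ with $\operatorname{Im}\tau>0$: $\gamma(\tau+1)=\gamma(\tau)$, $\gamma(-1/\tau)=\gamma(\tau)$ and $\gamma(-\bar\tau)=\gamma(\tau)$. In particular $\gamma(g\tau)=\gamma(\tau)$ for all $g\in SL(2,\mathbb Z)$, so $\gamma$ is modular-invariant, and it is symmetric with respect to the imaginary axis. (ii) Let $\tau_0=e^{i\pi/2}$ or $\tau_0=e^{i\pi/3}$. If $\gamma$, as a real function of $(\operatorname{Re}\tau,\operatorname{Im}\tau)$, is differentiable at $\tau_0$, then $\tau_0$ is a critical point of $\gamma$, i.e. the differential of $\gamma$ at $\tau_0$ vanishes. -/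

import Mathlib

namespace Abrikosov

open MeasureTheory

noncomputable section

/-! The plane `ℝ²` is identified with `ℂ` through `(x₁, x₂) ↦ x₁ + i x₂`; the Euclidean dot
product is the real inner product of `ℂ` and the coordinate directions are `1` and `I`. -/

/-- The matrix `J = (0 1; -1 0)` acting on the plane: `(x₁, x₂) ↦ (x₂, -x₁)`. -/
def rotJ (x : ℂ) : ℂ := ⟨x.im, -x.re⟩

/-- The vector potential `a⁰(x) = -½ J x` (constant magnetic field `curl a⁰ = 1`). -/
def vecPot (x : ℂ) : ℂ := -(1 / 2 : ℂ) * rotJ x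

/-- Component in the direction `e` of the covariant gradient `∇_a φ = ∇φ - i a φ`. -/
def covDeriv (a : ℂ → ℂ) (e : ℂ) (φ : ℂ → ℂ) (x : ℂ) : ℂ :=
  fderiv ℝ φ x e - Complex.I * ((inner ℝ (a x) e : ℝ) : ℂ) * φ x

/-- The covariant Laplacian `Δ_a = ∇_a · ∇_a`. -/
def covLaplacian (a : ℂ → ℂ) (φ : ℂ → ℂ) (x : ℂ) : ℂ :=
  covDeriv a 1 (covDeriv a 1 φ) x + covDeriv a Complex.I (covDeriv a Complex.I φ) x

/-- First basis vector `√(2π / Im τ)` of the normalized lattice. -/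
def latticeBasis₁ (τ : ℂ) : ℂ := (Real.sqrt (2 * Real.pi / τ.im) : ℂ)

/-- Second basis vector `√(2π / Im τ) τ` of the normalized lattice. -/
def latticeBasis₂ (τ : ℂ) : ℂ := (Real.sqrt (2 * Real.pi / τ.im) : ℂ) * τ

/-- The point `m ν₁ + n ν₂`. -/
def latticePoint (τ : ℂ) (m n : ℤ) : ℂ := m * latticeBasis₁ τ + n * latticeBasis₂ τ

/-- The lattice `L_τ = √(2π / Im τ) (ℤ + τ ℤ)`, whose cells have area `2π`. -/
def lattice (τ : ℂ) : AddSubgroup ℂ where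
  carrier := {s | ∃ m n : ℤ, latticePoint τ m n = s}
  zero_mem' := ⟨0, 0, by simp [latticePoint]⟩
  add_mem' := by
    rintro _ _ ⟨m, n, rfl⟩ ⟨m', n', rfl⟩
    exact ⟨m + m', n + n', by simp only [latticePoint]; push_cast; ring⟩
  neg_mem' := by
    rintro _ ⟨m, n, rfl⟩
    exact ⟨-m, -n, by simp only [latticePoint]; push_cast; ring⟩

/-- The dual group of `L_τ`: the characters `χ : L_τ → U(1)`. -/
abbrev DualGroup (τ : ℂ) : Type := AddChar (lattice τ) Circle

/-- The fundamental cell `{u ν₁ + v ν₂ : 0 ≤ u, v ≤ 1}` of `L_τ`, representing `ℝ² / L_τ`. -/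
def cell (τ : ℂ) : Set ℂ := parallelepiped ![latticeBasis₁ τ, latticeBasis₂ τ]

/-- `φ` is a normalized solution of the linear problem with character `χ`: it solves
`(-Δ_{a⁰} - 1) φ = 0`, it is gauge-periodic, `φ (x + s) = exp (i (½ s · J x + c_s)) χ(s) φ(x)` for
every `s = m ν₁ + n ν₂` in the lattice, and the average of `|φ|²` over a cell is `1`.

The constants `c_s = π m n` (taken to vanish on the basis `ν₁`, `ν₂`) are forced by the cocycle
condition `c_{s+t} - c_s - c_t - ½ s ∧ t ∈ 2πℤ`: as `ν₁ ∧ ν₂ = 2π`, without them the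
gauge-periodicity relations for `s`, `t` and `s + t` would be compatible only with `φ = 0`. -/
structure IsNormalizedSolution (τ : ℂ) (χ : DualGroup τ) (φ : ℂ → ℂ) : Prop where
  contDiff : ContDiff ℝ 2 φ
  equation : ∀ x, -covLaplacian vecPot φ x - φ x = 0
  gaugePeriodic : ∀ (m n : ℤ) (x : ℂ),
    φ (x + latticePoint τ m n) =
      Complex.exp (Complex.I *
          ((inner ℝ (latticePoint τ m n) (rotJ x) / 2 + Real.pi * m * n : ℝ) : ℂ)) *
        (χ ⟨latticePoint τ m n, m, n, rfl⟩ : ℂ) * φ x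
  normalized : ⨍ x in cell τ, ‖φ x‖ ^ 2 = 1

open Classical in
/-- The normalized solution `φ_χ`. For `Im τ > 0` it exists and is unique up to a constant factor
of modulus one, on which `gammaChi` does not depend. -/
def phi (τ : ℂ) (χ : DualGroup τ) : ℂ → ℂ :=
  if h : ∃ φ, IsNormalizedSolution τ χ φ then h.choose else 0

/-- `γ_χ(τ) = 2 ⟨|φ₀|² |φ_χ|²⟩ + |⟨φ₀² conj(φ_χ) conj(φ_{χ⁻¹})⟩| - ⟨|φ₀|⁴⟩`, where `φ₀` belongs to
the trivial character and `⟨·⟩` is the average over a cell. -/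
def gammaChi (τ : ℂ) (χ : DualGroup τ) : ℝ :=
  2 * (⨍ x in cell τ, ‖phi τ 1 x‖ ^ 2 * ‖phi τ χ x‖ ^ 2)
    + ‖⨍ x in cell τ, phi τ 1 x ^ 2 * (starRingEnd ℂ) (phi τ χ x) *
        (starRingEnd ℂ) (phi τ χ⁻¹ x)‖
    - ⨍ x in cell τ, ‖phi τ 1 x‖ ^ 4

/-- `γ(τ) = inf_χ γ_χ(τ)`, the infimum over all characters; it is used for `Im τ > 0`. -/
def gamma (τ : ℂ) : ℝ := ⨅ χ : DualGroup τ, gammaChi τ χ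

end

end Abrikosov

namespace Abrikosov

open MeasureTheory

open scoped Pointwise ComplexConjugate

noncomputable section

/-! The symmetries of `gamma` come from maps of the plane carrying the linear problem for one `τ` to
that for another. Since `phi` is only a choice, this needs uniqueness of normalized solutions up to
a unimodular constant; such constants drop out of `gammaChi`.

Uniqueness has two stages. Writing a solution as `gaussWeight * f`, the operator factors through
`dbar f`; periodicity bounds `gaussWeight * dbar f`, and Liouville forces `dbar f = 0`
(`dbar_eq_zero_of_solution`). So solutions are Gaussians times entire functions, which become theta
functions of degree one after rescaling. Their Fourier coefficients obey a one-step recursion, so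
the solution space has dimension at most one (`IsThetaSolution.exists_const_mul`).

Passing from `τ` to `τ + 1` keeps the lattice but changes the sign `(-1)^(mn)`, which a magnetic
translation by half a period repairs. The map `-1/τ` corresponds to a rotation and `-conj τ` to
complex conjugation. Each permutes the characters, so the infimum is unchanged
(`gamma_eq_of_transform`). Existence of solutions is never needed: nonexistence is transported as
well, and then both choices are zero.

For critical points, `I` and `exp (I π / 3)` are fixed by elliptic modular maps whose derivative is
a nontrivial root of unity. A real linear form invariant under such a multiplication vanishes. -/

/-! ### Period lattices and averages over cells -/

theorem latticeScale_pos {τ : ℂ} (hτ : 0 < τ.im) : 0 < Real.sqrt (2 * Real.pi / τ.im) :=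
  Real.sqrt_pos.mpr (by positivity)

theorem latticeScale_sq {τ : ℂ} (hτ : 0 < τ.im) :
    Real.sqrt (2 * Real.pi / τ.im) ^ 2 * τ.im = 2 * Real.pi := by
  rw [Real.sq_sqrt (by positivity)]
  field_simp

theorem linearIndependent_latticeBasis {τ : ℂ} (hτ : 0 < τ.im) :
    LinearIndependent ℝ ![latticeBasis₁ τ, latticeBasis₂ τ] := by
  have hr := latticeScale_pos hτ
  rw [LinearIndependent.pair_iff]
  intro a b h
  have h2 := congrArg Complex.im h
  have h1 := congrArg Complex.re h
  simp only [latticeBasis₁, latticeBasis₂, Complex.real_smul, Complex.add_im, Complex.add_re,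
    Complex.mul_im, Complex.mul_re, Complex.ofReal_re, Complex.ofReal_im, Complex.zero_re,
    Complex.zero_im] at h1 h2
  have hb : b = 0 := by
    have : b * (Real.sqrt (2 * Real.pi / τ.im) * τ.im) = 0 := by linarith
    rcases mul_eq_zero.mp this with h | h
    · exact h
    · exact absurd h (by positivity)
  subst hb
  refine ⟨?_, rfl⟩
  have : a * Real.sqrt (2 * Real.pi / τ.im) = 0 := by linarith
  rcases mul_eq_zero.mp this with h | h
  · exact h
  · exact absurd h hr.ne'

/-- The basis `ν₁, ν₂` of the plane. -/
def periodBasis {τ : ℂ} (hτ : 0 < τ.im) : Module.Basis (Fin 2) ℝ ℂ :=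
  basisOfLinearIndependentOfCardEqFinrank (linearIndependent_latticeBasis hτ)
    (by simp [Complex.finrank_real_complex])

theorem coe_periodBasis {τ : ℂ} (hτ : 0 < τ.im) :
    ⇑(periodBasis hτ) = ![latticeBasis₁ τ, latticeBasis₂ τ] :=
  coe_basisOfLinearIndependentOfCardEqFinrank _ _

theorem mem_span_periodBasis {τ : ℂ} (hτ : 0 < τ.im) (s : ℂ) :
    s ∈ Submodule.span ℤ (Set.range (periodBasis hτ)) ↔ s ∈ lattice τ := by
  rw [coe_periodBasis, Matrix.range_cons, Matrix.range_cons, Matrix.range_empty, Set.union_empty,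
    Set.singleton_union, Submodule.mem_span_pair]
  simp only [zsmul_eq_mul]
  rfl

theorem cell_ae_eq {τ : ℂ} (hτ : 0 < τ.im) :
    (cell τ : Set ℂ) =ᵐ[volume] ZSpan.fundamentalDomain (periodBasis hτ) := by
  have := ZSpan.fundamentalDomain_ae_parallelepiped (periodBasis hτ) (volume : Measure ℂ)
  rw [coe_periodBasis] at this
  exact this.symm

section Averages

variable {E : Type*} [NormedAddCommGroup E] [NormedSpace ℝ E]

/-- A translate of a fundamental domain is again one, and any two fundamental domains of the same
lattice give a periodic function the same integral. -/
theorem setIntegral_fundamentalDomain_comp_add {b b' : Module.Basis (Fin 2) ℝ ℂ}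
    (h : Submodule.span ℤ (Set.range b') = Submodule.span ℤ (Set.range b)) {F : ℂ → E}
    (hF : ∀ s ∈ Submodule.span ℤ (Set.range b), ∀ x, F (x + s) = F x) (t : ℂ) :
    ∫ x in ZSpan.fundamentalDomain b', F (x + t) = ∫ x in ZSpan.fundamentalDomain b, F x := by
  have h1 := ZSpan.isAddFundamentalDomain' b (volume : Measure ℂ)
  have h2 := ZSpan.isAddFundamentalDomain' b' (volume : Measure ℂ)
  rw [h] at h2
  have : Countable (Submodule.span ℤ (Set.range b)).toAddSubgroup :=
    inferInstanceAs (Countable (Submodule.span ℤ (Set.range b)))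
  have h3 := h2.vadd_of_comm t
  have h4 : ∫ x in t +ᵥ ZSpan.fundamentalDomain b', F x
      = ∫ x in ZSpan.fundamentalDomain b, F x := by
    refine h3.setIntegral_eq h1 fun g x => ?_
    have := hF g g.2 x
    rw [add_comm] at this
    exact this
  rw [← h4]
  have h5 := (measurePreserving_add_right (volume : Measure ℂ) t).setIntegral_image_emb
    (measurableEmbedding_addRight t) F (ZSpan.fundamentalDomain b')
  rw [← h5]
  congr 2
  simp only [← Set.image_vadd, vadd_eq_add, add_comm]

theorem setIntegral_cell_comp {τ τ' : ℂ} (hτ : 0 < τ.im) (hτ' : 0 < τ'.im) (A : ℂ ≃ₗᵢ[ℝ] ℂ)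
    (hA : ∀ s, s ∈ lattice τ' ↔ A s ∈ lattice τ) (t : ℂ) {F : ℂ → E}
    (hF : ∀ s ∈ lattice τ, ∀ x, F (x + s) = F x) :
    ∫ x in cell τ', F (A x + t) = ∫ x in cell τ, F x := by
  rw [setIntegral_congr_set (cell_ae_eq hτ), setIntegral_congr_set (cell_ae_eq hτ')]
  have h1 := A.measurePreserving.setIntegral_image_emb
    A.toHomeomorph.measurableEmbedding (fun y => F (y + t)) (ZSpan.fundamentalDomain (periodBasis hτ'))
  have h2 : A '' (ZSpan.fundamentalDomain (periodBasis hτ'))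
      = ZSpan.fundamentalDomain ((periodBasis hτ').map A.toLinearEquiv) :=
    ZSpan.map_fundamentalDomain _ A.toLinearEquiv
  rw [← h1, h2]
  refine setIntegral_fundamentalDomain_comp_add ?_ (fun s hs => hF s ?_) t
  · ext s
    rw [mem_span_periodBasis hτ, Module.Basis.coe_map, Set.range_comp]
    have h3 : Submodule.span ℤ (A.toLinearEquiv '' Set.range (periodBasis hτ'))
        = (Submodule.span ℤ (Set.range (periodBasis hτ'))).map
          (A.toLinearEquiv.toLinearMap.restrictScalars ℤ) :=
      (Submodule.map_span (A.toLinearEquiv.toLinearMap.restrictScalars ℤ) _).symm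
    rw [h3, Submodule.mem_map]
    constructor
    · rintro ⟨y, hy, rfl⟩
      exact (hA y).1 ((mem_span_periodBasis hτ' y).1 hy)
    · intro hs
      refine ⟨A.symm s, (mem_span_periodBasis hτ' _).2 ((hA _).2 (by simpa using hs)), ?_⟩
      exact A.apply_symm_apply s
  · exact (mem_span_periodBasis hτ s).1 hs

theorem setAverage_cell_comp {τ τ' : ℂ} (hτ : 0 < τ.im) (hτ' : 0 < τ'.im) (A : ℂ ≃ₗᵢ[ℝ] ℂ)
    (hA : ∀ s, s ∈ lattice τ' ↔ A s ∈ lattice τ) (t : ℂ) {F : ℂ → E}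
    (hF : ∀ s ∈ lattice τ, ∀ x, F (x + s) = F x) :
    ⨍ x in cell τ', F (A x + t) = ⨍ x in cell τ, F x := by
  rw [setAverage_eq, setAverage_eq, setIntegral_cell_comp hτ hτ' A hA t hF]
  -- The constant function `1` shows that the two cells have equal area.
  have := setIntegral_cell_comp hτ hτ' A hA t (F := fun _ => (1 : ℝ)) (fun _ _ _ => rfl)
  simp only [setIntegral_const, smul_eq_mul, mul_one] at this
  rw [this]

end Averages

theorem exists_bound_of_periodic {τ : ℂ} (hτ : 0 < τ.im) {P : ℂ → ℝ} (hP : Continuous P)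
    (hper : ∀ m n x, P (x + latticePoint τ m n) = P x) : ∃ C, ∀ x, P x ≤ C := by
  obtain ⟨C, hC⟩ := (isCompact_closedBall (0 : ℂ) (∑ i, ‖periodBasis hτ i‖)).bddAbove_image
    hP.continuousOn
  refine ⟨C, fun x => ?_⟩
  obtain ⟨m, n, hmn⟩ := (mem_span_periodBasis hτ _).1 (ZSpan.floor (periodBasis hτ) x).2
  have h := hper m n (ZSpan.fract (periodBasis hτ) x)
  rw [hmn, ZSpan.fract_apply, sub_add_cancel] at h
  rw [h, ← ZSpan.fract_apply]
  exact hC ⟨_, by simpa using ZSpan.norm_fract_le (periodBasis hτ) x, rfl⟩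

/-! ### The Gaussian factor and the factorization of the covariant Laplacian -/

/-- The Gaussian weight `exp (-|x|² / 4)`, as a complex-valued function. -/
def gaussWeight (x : ℂ) : ℂ := Complex.exp (-(x * conj x) / 4)

theorem gaussWeight_ne_zero (x : ℂ) : gaussWeight x ≠ 0 := Complex.exp_ne_zero _

theorem norm_gaussWeight (x : ℂ) : ‖gaussWeight x‖ = Real.exp (-‖x‖ ^ 2 / 4) := by
  rw [gaussWeight, Complex.norm_exp, Complex.mul_conj, Complex.normSq_eq_norm_sq]
  congr 1
  have : (-((‖x‖ ^ 2 : ℝ) : ℂ) / 4) = ((-‖x‖ ^ 2 / 4 : ℝ) : ℂ) := by push_cast; ring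
  rw [this, Complex.ofReal_re]

theorem hasFDerivAt_conj (x : ℂ) :
    HasFDerivAt (fun y : ℂ => conj y) (Complex.conjCLE : ℂ →L[ℝ] ℂ) x :=
  Complex.conjCLE.hasFDerivAt

theorem hasFDerivAt_exp_mul_conj (k x : ℂ) :
    HasFDerivAt (fun y : ℂ => Complex.exp (k * (y * conj y)))
      (Complex.exp (k * (x * conj x)) • (k •
        (x • (Complex.conjCLE : ℂ →L[ℝ] ℂ) + conj x • ContinuousLinearMap.id ℝ ℂ))) x :=
  (((hasFDerivAt_id (𝕜 := ℝ) x).mul (hasFDerivAt_conj x)).const_mul k).cexp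

theorem gaussWeight_eq : gaussWeight = fun y => Complex.exp ((-1 / 4) * (y * conj y)) := by
  funext y
  rw [gaussWeight]
  congr 1
  ring

theorem differentiable_gaussWeight : Differentiable ℝ gaussWeight := by
  intro x
  rw [gaussWeight_eq]
  exact (hasFDerivAt_exp_mul_conj _ x).differentiableAt

theorem fderiv_gaussWeight (x e : ℂ) :
    fderiv ℝ gaussWeight x e = -gaussWeight x * (x * conj e + e * conj x) / 4 := by
  rw [gaussWeight_eq, (hasFDerivAt_exp_mul_conj _ x).fderiv]
  simp
  ring

theorem I_mul_inner_rotJ (s x : ℂ) :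
    Complex.I * ((inner ℝ s (rotJ x) / 2 : ℝ) : ℂ) = (conj s * x - s * conj x) / 4 := by
  apply Complex.ext
  · simp [rotJ, Complex.inner]
  · simp [rotJ, Complex.inner]
    ring

theorem I_mul_inner_vecPot (x e : ℂ) :
    Complex.I * ((inner ℝ (vecPot x) e : ℝ) : ℂ) = -(conj e * x - e * conj x) / 4 := by
  apply Complex.ext
  · simp [vecPot, rotJ, Complex.inner]
  · simp [vecPot, rotJ, Complex.inner]
    ring

theorem covDeriv_gaussWeight_mul {f : ℂ → ℂ} {x : ℂ} (hf : DifferentiableAt ℝ f x) (e : ℂ) :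
    covDeriv vecPot e (fun y => gaussWeight y * f y) x =
      gaussWeight x * (fderiv ℝ f x e - e * conj x / 2 * f x) := by
  rw [covDeriv, fderiv_fun_mul (differentiable_gaussWeight x) hf, I_mul_inner_vecPot]
  simp [fderiv_gaussWeight]
  ring

/-- Twice the Wirtinger derivative `∂f/∂z̄`. -/
def dbar (f : ℂ → ℂ) (x : ℂ) : ℂ := fderiv ℝ f x 1 + Complex.I * fderiv ℝ f x Complex.I

theorem contDiff_fderiv_apply {f : ℂ → ℂ} (hf : ContDiff ℝ 2 f) (e : ℂ) :
    ContDiff ℝ 1 (fun y => fderiv ℝ f y e) :=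
  (hf.fderiv_right (by norm_num)).clm_apply contDiff_const

theorem contDiff_dbar {f : ℂ → ℂ} (hf : ContDiff ℝ 2 f) : ContDiff ℝ 1 (dbar f) :=
  (contDiff_fderiv_apply hf 1).add (contDiff_const.mul (contDiff_fderiv_apply hf Complex.I))

theorem fderiv_fderiv_comm {f : ℂ → ℂ} (hf : ContDiff ℝ 2 f) (x v w : ℂ) :
    fderiv ℝ (fun y => fderiv ℝ f y v) x w = fderiv ℝ (fun y => fderiv ℝ f y w) x v := by
  have hd : DifferentiableAt ℝ (fderiv ℝ f) x :=
    ((hf.fderiv_right (m := 1) (by norm_num)).differentiable (by norm_num)) x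
  have h := (hf.contDiffAt (x := x)).isSymmSndFDerivAt (by simp) w v
  rw [fderiv_clm_apply hd (differentiableAt_const v), fderiv_clm_apply hd (differentiableAt_const w)]
  simpa using h

/-- The Landau Hamiltonian minus its lowest level is a creation operator after an annihilation
operator. Conjugated by the Gaussian, the annihilation operator is `dbar`; symmetry of the second
derivative removes the mixed terms. -/
theorem covLaplacian_gaussWeight_mul {f : ℂ → ℂ} (hf : ContDiff ℝ 2 f) (x : ℂ) :
    -covLaplacian vecPot (fun y => gaussWeight y * f y) x - gaussWeight x * f x =
      gaussWeight x * (conj x * dbar f x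
        - (fderiv ℝ (dbar f) x 1 - Complex.I * fderiv ℝ (dbar f) x Complex.I)) := by
  have hfd : Differentiable ℝ f := hf.differentiable (by norm_num)
  have h1 : ∀ e, covDeriv vecPot e (fun y => gaussWeight y * f y) =
      fun y => gaussWeight y * (fderiv ℝ f y e - e * conj y / 2 * f y) := fun e => by
    funext y
    exact covDeriv_gaussWeight_mul (hfd y) e
  have hde : ∀ e, DifferentiableAt ℝ (fun y => fderiv ℝ f y e) x := fun e =>
    (contDiff_fderiv_apply hf e).differentiable (by norm_num) x
  have h2 : ∀ e, HasFDerivAt (fun y => e * conj y / 2 * f y)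
      ((e * conj x / 2) • fderiv ℝ f x + f x • ((e / 2) • (Complex.conjCLE : ℂ →L[ℝ] ℂ))) x := by
    intro e
    have hfun : (fun y => e * conj y / 2 * f y) = fun y => (e / 2 * conj y) * f y := by
      funext y
      ring
    rw [hfun, show e * conj x / 2 = e / 2 * conj x by ring]
    exact ((hasFDerivAt_conj x).const_mul (e / 2)).mul (hfd x).hasFDerivAt
  have h3 : ∀ e, fderiv ℝ (fun y => fderiv ℝ f y e - e * conj y / 2 * f y) x e =
      fderiv ℝ (fun y => fderiv ℝ f y e) x e
        - (e * conj x / 2 * fderiv ℝ f x e + f x * (e / 2 * conj e)) := by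
    intro e
    rw [fderiv_fun_sub (hde e) (h2 e).differentiableAt, (h2 e).fderiv]
    simp
  have h4 : ∀ e, fderiv ℝ (dbar f) x e = fderiv ℝ (fun y => fderiv ℝ f y 1) x e
      + Complex.I * fderiv ℝ (fun y => fderiv ℝ f y Complex.I) x e := by
    intro e
    have : dbar f = fun y => fderiv ℝ f y 1 + Complex.I * fderiv ℝ f y Complex.I := rfl
    rw [this, fderiv_fun_add (hde 1) ((hde Complex.I).const_mul _), fderiv_const_mul (hde _)]
    simp
  rw [covLaplacian, h1, h1,
    covDeriv_gaussWeight_mul ((hde 1).fun_sub (h2 1).differentiableAt),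
    covDeriv_gaussWeight_mul ((hde Complex.I).fun_sub (h2 Complex.I).differentiableAt), h3, h3, h4, h4,
    fderiv_fderiv_comm hf x Complex.I 1, dbar]
  simp only [map_one, Complex.conj_I]
  linear_combination (gaussWeight x * (-fderiv ℝ (fun y => fderiv ℝ f y Complex.I) x Complex.I
    - f x / 2 - conj x ^ 2 / 4 * f x)) * Complex.I_sq

theorem differentiableAt_of_dbar_eq_zero {f : ℂ → ℂ} {x : ℂ} (hf : DifferentiableAt ℝ f x)
    (h : dbar f x = 0) : DifferentiableAt ℂ f x := by
  refine differentiableAt_complex_iff_differentiableAt_real.2 ⟨hf, ?_⟩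
  rw [smul_eq_mul]
  rw [dbar] at h
  linear_combination (-Complex.I) * h + fderiv ℝ f x Complex.I * Complex.I_sq

theorem dbar_eq_zero {f : ℂ → ℂ} {x : ℂ} (hf : DifferentiableAt ℂ f x) : dbar f x = 0 := by
  have := (differentiableAt_complex_iff_differentiableAt_real.1 hf).2
  rw [dbar, this, smul_eq_mul]
  linear_combination fderiv ℝ f x 1 * Complex.I_sq

theorem dbar_mul {h f : ℂ → ℂ} {x : ℂ} (hh : DifferentiableAt ℂ h x)
    (hf : DifferentiableAt ℝ f x) : dbar (fun y => h y * f y) x = h x * dbar f x := by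
  have h0 := dbar_eq_zero hh
  rw [dbar] at h0
  rw [dbar, dbar, fderiv_fun_mul hh.real_of_complex hf]
  simp only [add_apply, smul_apply, smul_eq_mul]
  linear_combination f x * h0

/-- The function `exp (-|x|² / 2) * conj (∂f/∂z̄)` is holomorphic when `exp (-|x|² / 4) f` solves
the linear problem. -/
theorem differentiable_conj_dbar {f : ℂ → ℂ} (hf : ContDiff ℝ 2 f)
    (heq : ∀ x, fderiv ℝ (dbar f) x 1 - Complex.I * fderiv ℝ (dbar f) x Complex.I =
      conj x * dbar f x) :
    Differentiable ℂ (fun x => Complex.exp ((-1 / 2) * (x * conj x)) * conj (dbar f x)) := by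
  intro x
  have hd : DifferentiableAt ℝ (dbar f) x := (contDiff_dbar hf).differentiable (by norm_num) x
  have h1 : HasFDerivAt (fun y => conj (dbar f y))
      ((Complex.conjCLE : ℂ →L[ℝ] ℂ).comp (fderiv ℝ (dbar f) x)) x :=
    (hasFDerivAt_conj _).comp x hd.hasFDerivAt
  have h2 := (hasFDerivAt_exp_mul_conj (-1 / 2) x).mul h1
  refine differentiableAt_of_dbar_eq_zero h2.differentiableAt ?_
  rw [dbar]
  have h3 := congrArg conj (heq x)
  simp only [map_sub, map_mul, Complex.conj_I, Complex.conj_conj] at h3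
  erw [h2.fderiv]
  simp
  linear_combination Complex.exp (-1 / 2 * (x * conj x)) * h3 +
    Complex.exp (-1 / 2 * (x * conj x)) * conj (dbar f x) * (x / 2 - conj x / 2) * Complex.I_sq

/-! ### Reduction of the linear problem to entire functions -/

/-- The phase `exp (i/2 s · J x)` of the gauge-periodicity relation. -/
def gaugePhase (s x : ℂ) : ℂ := Complex.exp ((conj s * x - s * conj x) / 4)

theorem norm_gaugePhase (s x : ℂ) : ‖gaugePhase s x‖ = 1 := by
  rw [gaugePhase, ← I_mul_inner_rotJ, mul_comm, Complex.norm_exp_ofReal_mul_I]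

theorem gaussWeight_add (s x : ℂ) :
    gaussWeight (x + s) * Complex.exp (s * conj s / 4 + conj s * x / 2) =
      gaugePhase s x * gaussWeight x := by
  rw [gaussWeight, gaussWeight, gaugePhase, ← Complex.exp_add, ← Complex.exp_add, map_add]
  congr 1
  ring

/-- Gauge-periodic functions `exp (-|x|² / 4) f` with `f` entire, normalized, with multipliers
`μ m n`. -/
structure IsThetaSolution (τ : ℂ) (μ : ℤ → ℤ → ℂ) (φ : ℂ → ℂ) : Prop where
  entire : ∃ f : ℂ → ℂ, Differentiable ℂ f ∧ ∀ x, φ x = gaussWeight x * f x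
  quasiPeriodic : ∀ (m n : ℤ) (x : ℂ), φ (x + latticePoint τ m n) =
    gaugePhase (latticePoint τ m n) x * μ m n * φ x
  norm_multiplier : ∀ m n, ‖μ m n‖ = 1
  normalized : ⨍ x in cell τ, ‖φ x‖ ^ 2 = 1

/-- The multipliers `(-1)^(mn) χ(m ν₁ + n ν₂)`. -/
def multiplier (τ : ℂ) (χ : DualGroup τ) (m n : ℤ) : ℂ :=
  Complex.exp (Real.pi * m * n * Complex.I) * (χ ⟨latticePoint τ m n, m, n, rfl⟩ : ℂ)

theorem norm_multiplier (τ : ℂ) (χ : DualGroup τ) (m n : ℤ) : ‖multiplier τ χ m n‖ = 1 := by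
  have := Complex.norm_exp_ofReal_mul_I (Real.pi * m * n)
  push_cast at this
  rw [multiplier, norm_mul, this, Circle.norm_coe, mul_one]

theorem gaugeFactor_eq (τ : ℂ) (χ : DualGroup τ) (m n : ℤ) (x : ℂ) :
    Complex.exp (Complex.I *
          ((inner ℝ (latticePoint τ m n) (rotJ x) / 2 + Real.pi * m * n : ℝ) : ℂ)) *
        (χ ⟨latticePoint τ m n, m, n, rfl⟩ : ℂ) =
      gaugePhase (latticePoint τ m n) x * multiplier τ χ m n := by
  rw [gaugePhase, multiplier, ← I_mul_inner_rotJ, ← mul_assoc, ← Complex.exp_add]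
  congr 2
  push_cast
  ring

/-- Without the Gaussian, the factor of automorphy is holomorphic in `x`, so `dbar` passes through
it. -/
theorem quasiPeriodic_entirePart {f : ℂ → ℂ} {s c : ℂ}
    (h : ∀ x, gaussWeight (x + s) * f (x + s) = gaugePhase s x * c * (gaussWeight x * f x))
    (x : ℂ) : f (x + s) = c * Complex.exp (s * conj s / 4 + conj s * x / 2) * f x := by
  apply mul_left_cancel₀ (gaussWeight_ne_zero (x + s))
  rw [h]
  linear_combination (-c * f x) * gaussWeight_add s x

/-- Liouville's theorem for the entire function of `differentiable_conj_dbar`. Since `gaussWeight *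
dbar f` has the same multipliers as the solution, its modulus is periodic, hence bounded; the second
Gaussian factor then gives decay at infinity. -/
theorem dbar_eq_zero_of_solution {τ : ℂ} (hτ : 0 < τ.im) {μ : ℤ → ℤ → ℂ} {f : ℂ → ℂ}
    (hf : ContDiff ℝ 2 f)
    (heq : ∀ x, -covLaplacian vecPot (fun y => gaussWeight y * f y) x
      - gaussWeight x * f x = 0)
    (hper : ∀ m n x, gaussWeight (x + latticePoint τ m n) * f (x + latticePoint τ m n) =
      gaugePhase (latticePoint τ m n) x * μ m n * (gaussWeight x * f x))
    (hμ : ∀ m n, ‖μ m n‖ = 1) (x : ℂ) : dbar f x = 0 := by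
  have hfd : Differentiable ℝ f := hf.differentiable (by norm_num)
  have hG := differentiable_conj_dbar hf fun x => by
    have h1 := heq x
    rw [covLaplacian_gaussWeight_mul hf] at h1
    have h2 := (mul_eq_zero.1 h1).resolve_left (gaussWeight_ne_zero x)
    linear_combination -h2
  obtain ⟨C, hC⟩ := exists_bound_of_periodic hτ (P := fun x => ‖gaussWeight x * dbar f x‖)
    ((differentiable_gaussWeight.continuous.mul (contDiff_dbar hf).continuous).norm) (by
      intro m n x
      set s := latticePoint τ m n
      have h1 : dbar f (x + s) = dbar (fun y => f (y + s)) x := by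
        simp only [dbar, fderiv_comp_add_right]
      have h2 : (fun y => f (y + s)) =
          fun y => (μ m n * Complex.exp (s * conj s / 4 + conj s * y / 2)) * f y :=
        funext (quasiPeriodic_entirePart (hper m n))
      have h3 : dbar f (x + s) =
          (μ m n * Complex.exp (s * conj s / 4 + conj s * x / 2)) * dbar f x := by
        rw [h1, h2, dbar_mul (by fun_prop) (hfd x)]
      have h4 : gaussWeight (x + s) * dbar f (x + s) =
          gaugePhase s x * μ m n * (gaussWeight x * dbar f x) := by
        rw [h3]
        linear_combination (μ m n * dbar f x) * gaussWeight_add s x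
      rw [h4, norm_mul, norm_mul, norm_gaugePhase, hμ, one_mul, one_mul])
  -- The weight `exp (-|x|² / 2)` is `gaussWeight` squared: one factor is absorbed in the bound `C`,
  -- the other tends to zero.
  have hlim : Filter.Tendsto
      (fun x => Complex.exp ((-1 / 2) * (x * conj x)) * conj (dbar f x))
      (Filter.cocompact ℂ) (nhds 0) := by
    have h1 : Filter.Tendsto (fun x : ℂ => C * Real.exp (-‖x‖ ^ 2 / 4)) (Filter.cocompact ℂ)
        (nhds (C * 0)) := by
      refine Filter.Tendsto.const_mul C (Real.tendsto_exp_atBot.comp ?_)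
      have h2 : Filter.Tendsto (fun x : ℂ => ‖x‖ ^ 2) (Filter.cocompact ℂ) Filter.atTop :=
        (Filter.tendsto_pow_atTop two_ne_zero).comp (tendsto_norm_cocompact_atTop (E := ℂ))
      exact (Filter.tendsto_neg_atTop_atBot.comp h2).atBot_div_const (by norm_num)
    rw [mul_zero] at h1
    refine squeeze_zero_norm (fun y => ?_) h1
    have h3 : Complex.exp ((-1 / 2) * (y * conj y)) = gaussWeight y * gaussWeight y := by
      rw [gaussWeight, ← Complex.exp_add]
      congr 1
      ring
    rw [norm_mul, h3, RCLike.norm_conj, norm_mul, ← norm_gaussWeight]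
    have := hC y
    rw [norm_mul] at this
    nlinarith [norm_nonneg (gaussWeight y)]
  have := hG.apply_eq_of_tendsto_cocompact x hlim
  simpa [Complex.exp_ne_zero] using this

theorem isNormalizedSolution_iff {τ : ℂ} (hτ : 0 < τ.im) (χ : DualGroup τ) (φ : ℂ → ℂ) :
    IsNormalizedSolution τ χ φ ↔ IsThetaSolution τ (multiplier τ χ) φ := by
  constructor
  · intro h
    have hE : ContDiff ℝ 2 (fun x => Complex.exp ((1 / 4) * (x * conj x))) :=
      (contDiff_const.mul (contDiff_id.mul Complex.conjCLE.contDiff)).cexp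
    have hφ : ∀ x, φ x = gaussWeight x * (Complex.exp ((1 / 4) * (x * conj x)) * φ x) := fun x => by
      rw [gaussWeight, ← mul_assoc, ← Complex.exp_add,
        show -(x * conj x) / 4 + 1 / 4 * (x * conj x) = 0 by ring, Complex.exp_zero, one_mul]
    generalize hf : (fun x => Complex.exp ((1 / 4) * (x * conj x)) * φ x) = f
    have hfc : ContDiff ℝ 2 f := hf ▸ hE.mul h.contDiff
    have hφf : φ = fun x => gaussWeight x * f x := by
      subst hf
      exact funext hφ
    have hq : ∀ (m n : ℤ) (x : ℂ), φ (x + latticePoint τ m n) =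
        gaugePhase (latticePoint τ m n) x * multiplier τ χ m n * φ x := fun m n x => by
      rw [h.gaugePeriodic, gaugeFactor_eq]
    refine ⟨⟨f, fun x => ?_, fun x => congrFun hφf x⟩, hq, norm_multiplier τ χ, h.normalized⟩
    refine differentiableAt_of_dbar_eq_zero (hfc.differentiable (by norm_num) x)
      (dbar_eq_zero_of_solution hτ hfc ?_ ?_ (norm_multiplier τ χ) x)
    · intro y
      have := h.equation y
      rwa [hφf] at this
    · rw [hφf] at hq
      exact hq
  · intro h
    obtain ⟨f, hf, hφ⟩ := h.entire
    have hfc : ContDiff ℝ 2 f := (hf.contDiff (n := 2)).restrict_scalars ℝ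
    have hφf : φ = fun x => gaussWeight x * f x := funext hφ
    have hd : dbar f = 0 := funext fun x => dbar_eq_zero (hf x)
    refine ⟨?_, fun x => ?_, fun m n x => ?_, h.normalized⟩
    · rw [hφf, gaussWeight_eq]
      exact ((contDiff_const.mul (contDiff_id.mul Complex.conjCLE.contDiff)).cexp).mul hfc
    · have := covLaplacian_gaussWeight_mul hfc x
      rw [hd] at this
      rw [hφf, this]
      simp
    · rw [h.quasiPeriodic, gaugeFactor_eq]

/-! ### Uniqueness through theta functions of degree one -/

/-- A continuous `1`-periodic function whose Fourier coefficients vanish is zero. -/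
theorem eq_zero_of_integral_exp_eq_zero {g : ℝ → ℂ} (hg : Continuous g)
    (hper : Function.Periodic g 1)
    (h : ∀ n : ℤ, ∫ x in (0 : ℝ)..1, Complex.exp (2 * Real.pi * Complex.I * n * x) * g x = 0)
    (x : ℝ) : g x = 0 := by
  have : Fact (0 < (1 : ℝ)) := ⟨one_pos⟩
  let F : C(AddCircle (1 : ℝ), ℂ) := ⟨hper.lift, continuous_quot_lift _ hg⟩
  have hF : ∀ y : ℝ, F y = g y := fun y => hper.lift_coe y
  have hc : fourierCoeff F = 0 := by
    funext n
    rw [fourierCoeff_eq_intervalIntegral F n 0]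
    simp only [hF, fourier_coe_apply, smul_eq_mul, zero_add]
    have := h (-n)
    simp only [Complex.ofReal_one, div_one]
    rw [this]
    simp
  have hs := has_pointwise_sum_fourier_series_of_summable (f := F) (by rw [hc]; exact summable_zero) x
  rw [hc] at hs
  simp only [Pi.zero_apply, zero_smul] at hs
  rw [← hF]
  exact hs.unique hasSum_zero

/-- Cauchy's theorem on a rectangle of width one, whose vertical sides cancel by periodicity,
handles the imaginary part of `w`; real periodicity handles the real part. -/
theorem integral_line_eq_of_periodic {h : ℂ → ℂ} (hd : Differentiable ℂ h)
    (hper : ∀ w, h (w + 1) = h w) (w : ℂ) :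
    ∫ x in (0 : ℝ)..1, h (x + w) = ∫ x in (0 : ℝ)..1, h x := by
  have h1 := Complex.integral_boundary_rect_eq_zero_of_differentiableOn h 0 (1 + w.im * Complex.I)
    hd.differentiableOn
  have h2 : ∀ y : ℝ, h (1 + y * Complex.I) = h (y * Complex.I) := fun y => by
    rw [add_comm, hper]
  simp [h2] at h1
  have h3 : Function.Periodic (fun x : ℝ => h (x + w.im * Complex.I)) 1 := fun x => by
    push_cast
    rw [← hper (x + w.im * Complex.I)]
    ring_nf
  have h4 := h3.intervalIntegral_add_eq w.re 0
  rw [zero_add, ← sub_eq_zero.1 h1] at h4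
  rw [← h4]
  have h5 := intervalIntegral.integral_comp_add_right (a := 0) (b := 1)
    (fun x : ℝ => h (x + w.im * Complex.I)) w.re
  rw [zero_add, add_comm 1] at h5
  rw [← h5]
  congr 1
  funext x
  congr 1
  conv_lhs => rw [← Complex.re_add_im w]
  push_cast
  ring

/-- A theta function of degree one whose mean over a period vanishes is zero. -/
theorem theta_eq_zero_of_integral_eq_zero {k : ℂ → ℂ} (hk : Differentiable ℂ k) {τ c : ℂ}
    (h1 : ∀ w, k (w + 1) = k w)
    (hτ : ∀ w, k (w + τ) = c * Complex.exp (-(2 * Real.pi * Complex.I * w)) * k w) (hc : c ≠ 0)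
    (h0 : ∫ x in (0 : ℝ)..1, k x = 0) (w : ℂ) : k w = 0 := by
  set e : ℤ → ℂ → ℂ := fun n z => Complex.exp (2 * Real.pi * Complex.I * n * z) with he
  have hper : ∀ n z, e n (z + 1) * k (z + 1) = e n z * k z := fun n z => by
    rw [h1, he]
    simp only
    rw [mul_add, Complex.exp_add, mul_one,
      show 2 * (Real.pi : ℂ) * Complex.I * n = n * (2 * Real.pi * Complex.I) by ring,
      Complex.exp_int_mul_two_pi_mul_I, mul_one]
  have hline : ∀ (n : ℤ) (z : ℂ), ∫ x in (0 : ℝ)..1, e n (x + z) * k (x + z) =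
      ∫ x in (0 : ℝ)..1, e n x * k x := fun n z =>
    integral_line_eq_of_periodic (h := fun y => e n y * k y) (by fun_prop) (hper n) z
  -- Shifting the contour by `τ` brings in the factor `exp (-2πiw)`, which lowers the frequency by
  -- exactly one. As `c * e n τ` is nonzero, vanishing at `n = 0` spreads in both directions.
  have hstep : ∀ n : ℤ, ∫ x in (0 : ℝ)..1, e n x * k x =
      c * e n τ * ∫ x in (0 : ℝ)..1, e (n - 1) x * k x := fun n => by
    rw [← hline n τ, ← intervalIntegral.integral_const_mul]
    congr 1
    funext x
    rw [hτ, he]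
    simp only
    rw [mul_add, Complex.exp_add, show 2 * (Real.pi : ℂ) * Complex.I * ((n - 1 : ℤ) : ℂ) * x =
      2 * Real.pi * Complex.I * n * x + -(2 * Real.pi * Complex.I * x) by push_cast; ring,
      Complex.exp_add]
    ring
  have hall : ∀ n : ℤ, ∫ x in (0 : ℝ)..1, e n x * k x = 0 := by
    intro n
    induction n using Int.induction_on with
    | zero => simpa [he] using h0
    | succ n ih =>
      rw [hstep, add_sub_cancel_right, ih, mul_zero]
    | pred n ih =>
      rw [hstep] at ih
      exact (mul_eq_zero.1 ih).resolve_left (mul_ne_zero hc (Complex.exp_ne_zero _))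
  have hfin := eq_zero_of_integral_exp_eq_zero (g := fun x : ℝ => k (x + w))
    (hk.continuous.comp (by fun_prop)) (fun x => by
      change k (((x + 1 : ℝ) : ℂ) + w) = k (x + w)
      rw [← h1 (x + w)]
      push_cast
      ring_nf) (fun n => ?_) 0
  · simpa using hfin
  · have h2 := hline n w
    rw [hall] at h2
    have h3 : ∀ x : ℝ, e n (x + w) * k (x + w) = e n w *
        (Complex.exp (2 * Real.pi * Complex.I * n * x) * k (x + w)) := fun x => by
      rw [he]
      simp only
      rw [mul_add, Complex.exp_add]
      ring
    simp only [h3] at h2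
    rw [intervalIntegral.integral_const_mul] at h2
    exact (mul_eq_zero.1 h2).resolve_left (Complex.exp_ne_zero _)

/-- The entire part of a gauge-periodic function, rescaled to a theta function with period one. -/
def thetaPart (r θ : ℂ) (f : ℂ → ℂ) (w : ℂ) : ℂ :=
  Complex.exp (-(r * w) ^ 2 / 4 - θ * w) * f (r * w)

/-- With `a`, `b` the means of the two theta functions, the combination `a * g - b * f` has mean
zero and so vanishes. Normalization gives both `a ≠ 0` and `‖b / a‖ = 1`. -/
theorem IsThetaSolution.exists_const_mul {τ : ℂ} (hτ : 0 < τ.im) {μ : ℤ → ℤ → ℂ} {φ ψ : ℂ → ℂ}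
    (hφ : IsThetaSolution τ μ φ) (hψ : IsThetaSolution τ μ ψ) :
    ∃ c : ℂ, ‖c‖ = 1 ∧ ∀ x, ψ x = c * φ x := by
  obtain ⟨f, hf, hφf⟩ := hφ.entire
  obtain ⟨g, hg, hψg⟩ := hψ.entire
  set r := Real.sqrt (2 * Real.pi / τ.im) with hr
  have hr0 : (r : ℂ) ≠ 0 := Complex.ofReal_ne_zero.2 (latticeScale_pos hτ).ne'
  have hμ0 : ∀ m n, μ m n ≠ 0 := fun m n => norm_ne_zero_iff.1 (by rw [hφ.norm_multiplier]; simp)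
  have hν₁ : latticePoint τ 1 0 = r := by simp [latticePoint, latticeBasis₁, hr]
  have hν₂ : latticePoint τ 0 1 = r * τ := by simp [latticePoint, latticeBasis₂, hr]
  -- The linear exponent with this `θ` cancels the multiplier of the first period, leaving a
  -- function of period exactly one.
  set θ := Complex.log (μ 1 0)
  have hθ : Complex.exp θ = μ 1 0 := Complex.exp_log (hμ0 1 0)
  have key : ∀ {χ F}, IsThetaSolution τ μ χ → Differentiable ℂ F →
      (∀ x, χ x = gaussWeight x * F x) →
      (∀ w, thetaPart r θ F (w + 1) = thetaPart r θ F w) ∧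
      ∀ w, thetaPart r θ F (w + τ) =
        (μ 0 1 * Complex.exp (r ^ 2 * τ * conj τ / 4 - r ^ 2 * τ ^ 2 / 4 - θ * τ)) *
          Complex.exp (-(2 * Real.pi * Complex.I * w)) * thetaPart r θ F w := by
    intro χ F hχ hF hχF
    have hq : ∀ m n x, _ := fun m n => quasiPeriodic_entirePart (f := F)
      (fun x => by simpa only [hχF] using hχ.quasiPeriodic m n x)
    constructor
    · intro w
      have := hq 1 0 (r * w)
      rw [hν₁, ← hθ, Complex.conj_ofReal, ← Complex.exp_add] at this
      rw [thetaPart, thetaPart, mul_add, mul_one, this, ← mul_assoc, ← Complex.exp_add]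
      congr 2
      ring
    · intro w
      have := hq 0 1 (r * w)
      rw [hν₂, map_mul, Complex.conj_ofReal] at this
      -- This is where the cell area `2π` enters: it makes the theta function have degree one.
      have hw : r ^ 2 * (τ - conj τ) = 4 * Real.pi * Complex.I := by
        have h1 := latticeScale_sq hτ
        rw [Complex.sub_conj, ← hr] at *
        have h2 : (r : ℂ) ^ 2 * τ.im = 2 * Real.pi := by exact_mod_cast h1
        push_cast
        linear_combination 2 * Complex.I * h2
      rw [thetaPart, thetaPart, mul_add, this]
      have hexp : Complex.exp (-(r * w + r * τ) ^ 2 / 4 - θ * (w + τ)) *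
          Complex.exp (r * τ * (r * conj τ) / 4 + r * conj τ * (r * w) / 2) =
          Complex.exp (r ^ 2 * τ * conj τ / 4 - r ^ 2 * τ ^ 2 / 4 - θ * τ) *
          Complex.exp (-(2 * Real.pi * Complex.I * w)) *
          Complex.exp (-(r * w) ^ 2 / 4 - θ * w) := by
        rw [← Complex.exp_add, ← Complex.exp_add, ← Complex.exp_add]
        congr 1
        linear_combination (-w / 2) * hw
      linear_combination (μ 0 1 * F (r * w)) * hexp
  have hdiff : ∀ {F : ℂ → ℂ}, Differentiable ℂ F → Differentiable ℂ (thetaPart r θ F) := by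
    intro F hF
    unfold thetaPart
    fun_prop
  have hzero : ∀ {F : ℂ → ℂ}, (∀ w, thetaPart r θ F w = 0) → ∀ x, F x = 0 := by
    intro F h x
    have := h (x / r)
    rw [thetaPart, mul_div_cancel₀ _ hr0] at this
    exact (mul_eq_zero.1 this).resolve_left (Complex.exp_ne_zero _)
  obtain ⟨hf1, hf2⟩ := key hφ hf hφf
  obtain ⟨hg1, hg2⟩ := key hψ hg hψg
  have hc := mul_ne_zero (hμ0 0 1)
    (Complex.exp_ne_zero (r ^ 2 * τ * conj τ / 4 - r ^ 2 * τ ^ 2 / 4 - θ * τ))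
  set a := ∫ x in (0 : ℝ)..1, thetaPart r θ f x with ha
  set b := ∫ x in (0 : ℝ)..1, thetaPart r θ g x with hb
  have ha0 : a ≠ 0 := by
    intro h0
    have h1 := hzero (theta_eq_zero_of_integral_eq_zero (hdiff hf) hf1 hf2 hc h0)
    have h2 := hφ.normalized
    simp [hφf, h1] at h2
  have hlin : ∀ w, thetaPart r θ (fun x => a * g x - b * f x) w =
      a * thetaPart r θ g w - b * thetaPart r θ f w := fun w => by
    simp only [thetaPart]
    ring
  have hcomb := hzero (F := fun x => a * g x - b * f x) (theta_eq_zero_of_integral_eq_zero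
    (hdiff (by fun_prop)) (τ := τ) (fun w => by rw [hlin, hlin, hf1, hg1])
    (fun w => by
      rw [hlin, hlin, hf2, hg2]
      ring) hc (by
      simp only [hlin]
      rw [intervalIntegral.integral_sub, intervalIntegral.integral_const_mul,
        intervalIntegral.integral_const_mul, ← ha, ← hb]
      · ring
      · exact ((continuous_const.mul ((hdiff hg).continuous.comp
          Complex.continuous_ofReal))).intervalIntegrable _ _
      · exact ((continuous_const.mul ((hdiff hf).continuous.comp
          Complex.continuous_ofReal))).intervalIntegrable _ _))
  have hψφ : ∀ x, ψ x = b / a * φ x := fun x => by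
    rw [hψg, hφf]
    field_simp
    linear_combination gaussWeight x * hcomb x
  refine ⟨b / a, ?_, hψφ⟩
  have h1 := hψ.normalized
  simp only [hψφ, norm_mul, mul_pow] at h1
  rw [setAverage_eq, integral_const_mul, smul_eq_mul, mul_left_comm, ← smul_eq_mul (_⁻¹),
    ← setAverage_eq, hφ.normalized, mul_one] at h1
  rwa [pow_eq_one_iff_of_nonneg (norm_nonneg _) two_ne_zero] at h1

/-! ### Transport of solutions by translations, rotations and conjugation -/

theorem gaugePhase_mul_conj (s x : ℂ) : gaugePhase s x * conj (gaugePhase s x) = 1 := by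
  rw [Complex.mul_conj, Complex.normSq_eq_norm_sq, norm_gaugePhase]
  simp

theorem IsThetaSolution.norm_periodic {τ : ℂ} {μ : ℤ → ℤ → ℂ} {φ : ℂ → ℂ}
    (h : IsThetaSolution τ μ φ) : ∀ s ∈ lattice τ, ∀ x, ‖φ (x + s)‖ = ‖φ x‖ := by
  rintro _ ⟨m, n, rfl⟩ x
  rw [h.quasiPeriodic, norm_mul, norm_mul, norm_gaugePhase, h.norm_multiplier, one_mul, one_mul]

theorem IsThetaSolution.congr_multiplier {τ : ℂ} {μ μ' : ℤ → ℤ → ℂ} {φ : ℂ → ℂ}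
    (h : IsThetaSolution τ μ φ) (hμ : ∀ m n, μ m n = μ' m n) : IsThetaSolution τ μ' φ := by
  rwa [← funext fun m => funext (hμ m)]

/-- Magnetic translations. -/
theorem IsThetaSolution.translate {τ τ' : ℂ} (hτ : 0 < τ.im) (hτ' : 0 < τ'.im) {μ : ℤ → ℤ → ℂ}
    {φ : ℂ → ℂ} (h : IsThetaSolution τ μ φ) {p q : ℤ → ℤ → ℤ}
    (hpq : ∀ m n, latticePoint τ' m n = latticePoint τ (p m n) (q m n))
    (hlat : ∀ s, s ∈ lattice τ' ↔ s ∈ lattice τ) (t : ℂ) :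
    IsThetaSolution τ' (fun m n => μ (p m n) (q m n) * gaugePhase (latticePoint τ' m n) t ^ 2)
      (fun x => gaugePhase (-t) x * φ (x + t)) := by
  obtain ⟨f, hf, hφf⟩ := h.entire
  refine ⟨⟨fun x => Complex.exp (-t * conj t / 4 - conj t * x / 2) * f (x + t), by fun_prop, ?_⟩,
    ?_, ?_, ?_⟩
  · intro x
    rw [hφf, ← mul_assoc, ← mul_assoc]
    congr 1
    rw [gaugePhase, gaussWeight, gaussWeight, ← Complex.exp_add, ← Complex.exp_add]
    congr 1
    simp only [map_neg, map_add]
    ring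
  · intro m n x
    have h1 := h.quasiPeriodic (p m n) (q m n) (x + t)
    rw [← hpq] at h1
    set s := latticePoint τ' m n
    rw [show x + s + t = x + t + s by ring, h1]
    -- The phase is the exponential of an antisymmetric form, so the prefactor and the shifted
    -- argument each contribute `gaugePhase s t`; hence the square.
    have h2 : gaugePhase (-t) (x + s) * gaugePhase s (x + t) =
        gaugePhase s x * gaugePhase s t ^ 2 * gaugePhase (-t) x := by
      simp only [gaugePhase, ← Complex.exp_add, ← Complex.exp_nat_mul]
      congr 1
      simp only [map_neg, map_add]
      push_cast
      ring
    linear_combination μ (p m n) (q m n) * φ (x + t) * h2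
  · intro m n
    rw [norm_mul, norm_pow, norm_gaugePhase, h.norm_multiplier]
    norm_num
  · simp only [norm_mul, norm_gaugePhase, one_mul]
    rw [← h.normalized]
    exact setAverage_cell_comp hτ hτ' (LinearIsometryEquiv.refl ℝ ℂ) hlat t
      (F := fun x => ‖φ x‖ ^ 2) (fun s hs x => by rw [h.norm_periodic s hs])

/-- Both `|x|` and the symplectic form in the gauge phase are invariant under rotations. -/
theorem IsThetaSolution.rotate {τ τ' : ℂ} (hτ : 0 < τ.im) (hτ' : 0 < τ'.im) {μ : ℤ → ℤ → ℂ}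
    {φ : ℂ → ℂ} (h : IsThetaSolution τ μ φ) (u : Circle) {p q : ℤ → ℤ → ℤ}
    (hpq : ∀ m n, u * latticePoint τ' m n = latticePoint τ (p m n) (q m n))
    (hlat : ∀ s, s ∈ lattice τ' ↔ (u : ℂ) * s ∈ lattice τ) :
    IsThetaSolution τ' (fun m n => μ (p m n) (q m n)) (fun x => φ (u * x)) := by
  obtain ⟨f, hf, hφf⟩ := h.entire
  have hu : (u : ℂ) * conj (u : ℂ) = 1 := by
    rw [Complex.mul_conj, Complex.normSq_eq_norm_sq, Circle.norm_coe]
    simp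
  refine ⟨⟨fun x => f (u * x), by fun_prop, ?_⟩, ?_, fun m n => h.norm_multiplier _ _, ?_⟩
  · intro x
    rw [hφf, gaussWeight, gaussWeight, map_mul]
    congr 2
    linear_combination (-x * conj x / 4) * hu
  · intro m n x
    rw [mul_add, hpq, h.quasiPeriodic, ← hpq, gaugePhase, gaugePhase, map_mul]
    congr 3
    linear_combination
      ((conj (latticePoint τ' m n) * x - latticePoint τ' m n * conj x) / 4) * hu +
      (latticePoint τ' m n / 4) * u * (map_mul conj (u : ℂ) x).symm
  · rw [← h.normalized]
    have := setAverage_cell_comp hτ hτ' (rotation u) (by simpa [rotation_apply] using hlat) 0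
      (F := fun x => ‖φ x‖ ^ 2) (fun s hs x => by rw [h.norm_periodic s hs])
    simpa [rotation_apply] using this

/-- A reflection reverses the symplectic form, and conjugating the values reverses the phase back;
the multipliers are left conjugated. -/
theorem IsThetaSolution.conj {τ τ' : ℂ} (hτ : 0 < τ.im) (hτ' : 0 < τ'.im) {μ : ℤ → ℤ → ℂ}
    {φ : ℂ → ℂ} (h : IsThetaSolution τ μ φ) {p q : ℤ → ℤ → ℤ}
    (hpq : ∀ m n, conj (latticePoint τ' m n) = latticePoint τ (p m n) (q m n))
    (hlat : ∀ s, s ∈ lattice τ' ↔ conj s ∈ lattice τ) :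
    IsThetaSolution τ' (fun m n => conj (μ (p m n) (q m n))) (fun x => conj (φ (conj x))) := by
  obtain ⟨f, hf, hφf⟩ := h.entire
  refine ⟨⟨fun x => conj (f (conj x)), fun x => ?_, ?_⟩, ?_, ?_, ?_⟩
  · have := (hf (conj x)).conj_conj
    rwa [Complex.conj_conj] at this
  · intro x
    rw [hφf, map_mul, gaussWeight, gaussWeight, ← Complex.exp_conj]
    congr 2
    simp [map_ofNat]
  · intro m n x
    rw [map_add, hpq, h.quasiPeriodic, ← hpq, map_mul, map_mul, gaugePhase, gaugePhase,
      ← Complex.exp_conj]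
    congr 3
    simp [map_ofNat]
  · intro m n
    rw [RCLike.norm_conj, h.norm_multiplier]
  · rw [← h.normalized]
    have := setAverage_cell_comp hτ hτ' Complex.conjLIE (by simpa using hlat) 0
      (F := fun x => ‖φ x‖ ^ 2) (fun s hs x => by rw [h.norm_periodic s hs])
    simpa using this

/-! ### Periodicity of the averaged expressions -/

theorem phi_spec {τ : ℂ} {χ : DualGroup τ} (h : ∃ φ, IsNormalizedSolution τ χ φ) :
    IsNormalizedSolution τ χ (phi τ χ) := by
  rw [phi, dif_pos h]
  exact h.choose_spec

theorem phi_eq_zero {τ : ℂ} {χ : DualGroup τ} (h : ¬∃ φ, IsNormalizedSolution τ χ φ) :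
    phi τ χ = 0 := by
  rw [phi, dif_neg h]

/-- This also covers the default value `0`, so periodicity of the averaged expressions requires no
existence result. -/
theorem phi_quasiPeriodic (τ : ℂ) (χ : DualGroup τ) (m n : ℤ) (x : ℂ) :
    phi τ χ (x + latticePoint τ m n) =
      gaugePhase (latticePoint τ m n) x * multiplier τ χ m n * phi τ χ x := by
  by_cases h : ∃ φ, IsNormalizedSolution τ χ φ
  · rw [(phi_spec h).gaugePeriodic, gaugeFactor_eq]
  · simp [phi_eq_zero h]

theorem norm_phi_periodic (τ : ℂ) (χ : DualGroup τ) :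
    ∀ s ∈ lattice τ, ∀ x, ‖phi τ χ (x + s)‖ = ‖phi τ χ x‖ := by
  rintro _ ⟨m, n, rfl⟩ x
  rw [phi_quasiPeriodic, norm_mul, norm_mul, norm_gaugePhase, norm_multiplier, one_mul, one_mul]

/-- The pairing of `χ` with `χ⁻¹` cancels the characters, and all remaining factors are unimodular.
This makes the product under the second average truly periodic. -/
theorem multiplier_one_sq (τ : ℂ) (χ : DualGroup τ) (m n : ℤ) :
    multiplier τ 1 m n ^ 2 * (conj (multiplier τ χ m n) * conj (multiplier τ χ⁻¹ m n)) = 1 := by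
  have h1 : multiplier τ 1 m n ^ 2 = multiplier τ χ m n * multiplier τ χ⁻¹ m n := by
    have : (χ ⟨latticePoint τ m n, m, n, rfl⟩ : ℂ) * (χ⁻¹ ⟨latticePoint τ m n, m, n, rfl⟩ : Circle) = 1 := by
      rw [AddChar.inv_apply', ← Circle.coe_mul, mul_inv_cancel, Circle.coe_one]
    simp only [multiplier, AddChar.one_apply, Circle.coe_one]
    linear_combination (-Complex.exp (Real.pi * m * n * Complex.I) ^ 2) * this
  have h2 : ∀ ψ : DualGroup τ, multiplier τ ψ m n * conj (multiplier τ ψ m n) = 1 := fun ψ => by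
    rw [Complex.mul_conj, Complex.normSq_eq_norm_sq, norm_multiplier]
    simp
  rw [h1]
  linear_combination multiplier τ χ⁻¹ m n * conj (multiplier τ χ⁻¹ m n) * h2 χ + h2 χ⁻¹

theorem phi_product_periodic (τ : ℂ) (χ : DualGroup τ) : ∀ s ∈ lattice τ, ∀ x,
    phi τ 1 (x + s) ^ 2 * conj (phi τ χ (x + s)) * conj (phi τ χ⁻¹ (x + s)) =
      phi τ 1 x ^ 2 * conj (phi τ χ x) * conj (phi τ χ⁻¹ x) := by
  rintro _ ⟨m, n, rfl⟩ x
  simp only [phi_quasiPeriodic, map_mul]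
  have h1 := gaugePhase_mul_conj (latticePoint τ m n) x
  have h2 := multiplier_one_sq τ χ m n
  set g := gaugePhase (latticePoint τ m n) x
  have h3 : g ^ 2 * conj g ^ 2 = 1 := by rw [← mul_pow, h1, one_pow]
  linear_combination phi τ 1 x ^ 2 * conj (phi τ χ x) * conj (phi τ χ⁻¹ x) *
    (h2 + multiplier τ 1 m n ^ 2 * (conj (multiplier τ χ m n) * conj (multiplier τ χ⁻¹ m n)) * h3)

/-! ### Pullback of characters and the invariance principle -/

/-- The restriction to the lattices of an additive map of the plane. -/
def latticeMap {τ τ' : ℂ} (B : ℂ ≃+ ℂ) (hB : ∀ s, s ∈ lattice τ' ↔ B s ∈ lattice τ) :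
    lattice τ' →+ lattice τ :=
  (B.toAddMonoidHom.comp (lattice τ').subtype).codRestrict (lattice τ) fun s => (hB s).1 s.2

/-- Pullback of characters along an additive map of the plane between lattices. -/
def pullback {τ τ' : ℂ} (B : ℂ ≃+ ℂ) (hB : ∀ s, s ∈ lattice τ' ↔ B s ∈ lattice τ)
    (χ : DualGroup τ) : DualGroup τ' := χ.compAddMonoidHom (latticeMap B hB)

theorem pullback_apply {τ τ' : ℂ} (B : ℂ ≃+ ℂ) (hB : ∀ s, s ∈ lattice τ' ↔ B s ∈ lattice τ)
    (χ : DualGroup τ) (s : lattice τ') : pullback B hB χ s = χ ⟨B s, (hB s).1 s.2⟩ := rfl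

theorem pullback_surjective {τ τ' : ℂ} (B : ℂ ≃+ ℂ)
    (hB : ∀ s, s ∈ lattice τ' ↔ B s ∈ lattice τ) : Function.Surjective (pullback B hB) := by
  intro χ
  refine ⟨pullback B.symm (fun s => ?_) χ, ?_⟩
  · rw [hB, B.apply_symm_apply]
  · ext s
    simp [pullback_apply]

theorem pullback_latticePoint {τ τ' : ℂ} (B : ℂ ≃+ ℂ)
    (hB : ∀ s, s ∈ lattice τ' ↔ B s ∈ lattice τ) (χ : DualGroup τ) {m n p q : ℤ}
    (h : B (latticePoint τ' m n) = latticePoint τ p q) :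
    pullback B hB χ ⟨latticePoint τ' m n, m, n, rfl⟩ = χ ⟨latticePoint τ p q, p, q, rfl⟩ := by
  rw [pullback_apply]
  simp only [h]

theorem multiplier_pullback {τ τ' : ℂ} (B : ℂ ≃+ ℂ)
    (hB : ∀ s, s ∈ lattice τ' ↔ B s ∈ lattice τ) (χ : DualGroup τ) {m n p q : ℤ}
    (h : B (latticePoint τ' m n) = latticePoint τ p q) :
    multiplier τ' (pullback B hB χ) m n =
      Complex.exp (Real.pi * m * n * Complex.I) * (χ ⟨latticePoint τ p q, p, q, rfl⟩ : ℂ) := by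
  rw [multiplier, pullback_latticePoint B hB χ h]

/-- Invariance of `γ` under a map of the plane which, combined with a phase and possibly a complex
conjugation, carries the solutions for `τ` to the solutions for `τ'`. -/
theorem gamma_eq_of_transform {τ τ' : ℂ} (hτ : 0 < τ.im) (hτ' : 0 < τ'.im) (B : ℂ ≃+ ℂ)
    (hB : ∀ s, s ∈ lattice τ' ↔ B s ∈ lattice τ) (A : ℂ ≃ₗᵢ[ℝ] ℂ)
    (hA : ∀ s, s ∈ lattice τ' ↔ A s ∈ lattice τ) (t : ℂ) (G : ℂ → ℂ) (hG : ∀ x, ‖G x‖ = 1)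
    (κ : ℂ →+* ℂ) (hκ : κ = RingHom.id ℂ ∨ κ = starRingEnd ℂ)
    (hsol : ∀ χ φ, IsThetaSolution τ (multiplier τ χ) φ →
      IsThetaSolution τ' (multiplier τ' (pullback B hB χ)) (fun x => G x * κ (φ (A x + t))))
    (hback : ∀ χ φ, IsThetaSolution τ' (multiplier τ' (pullback B hB χ)) φ →
      ∃ ψ, IsThetaSolution τ (multiplier τ χ) ψ) :
    gamma τ' = gamma τ := by
  have hκn : ∀ z, ‖κ z‖ = ‖z‖ := fun z => by
    rcases hκ with rfl | rfl
    · rfl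
    · exact RCLike.norm_conj z
  have hκc : ∀ z, κ (conj z) = conj (κ z) := fun z => by
    rcases hκ with rfl | rfl <;> rfl
  have hphi : ∀ χ, ∃ c : ℂ, ‖c‖ = 1 ∧
      ∀ x, phi τ' (pullback B hB χ) x = c * (G x * κ (phi τ χ (A x + t))) := by
    intro χ
    by_cases h : ∃ φ, IsNormalizedSolution τ χ φ
    · have h1 := hsol χ _ ((isNormalizedSolution_iff hτ χ _).1 (phi_spec h))
      exact h1.exists_const_mul hτ' ((isNormalizedSolution_iff hτ' _ _).1
        (phi_spec ⟨_, (isNormalizedSolution_iff hτ' _ _).2 h1⟩))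
    -- If either problem has no solution, neither has, and both choices are the default `0`.
    · have h' : ¬∃ φ, IsNormalizedSolution τ' (pullback B hB χ) φ := fun ⟨φ, hφ⟩ => h <| by
        obtain ⟨ψ, hψ⟩ := hback χ φ ((isNormalizedSolution_iff hτ' _ _).1 hφ)
        exact ⟨ψ, (isNormalizedSolution_iff hτ _ _).2 hψ⟩
      exact ⟨1, by simp, fun x => by simp [phi_eq_zero h, phi_eq_zero h']⟩
  have hnorm : ∀ χ x, ‖phi τ' (pullback B hB χ) x‖ = ‖phi τ χ (A x + t)‖ := fun χ x => by
    obtain ⟨c, hc, h⟩ := hphi χ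
    rw [h, norm_mul, norm_mul, hc, hG, hκn, one_mul, one_mul]
  have hone : (1 : DualGroup τ') = pullback B hB 1 := rfl
  have hinv : ∀ χ, (pullback B hB χ)⁻¹ = pullback B hB χ⁻¹ := fun χ => by
    ext s
    simp only [AddChar.inv_apply, pullback_apply, NegMemClass.coe_neg, map_neg]
    rfl
  refine Function.Surjective.iInf_congr (pullback B hB) (pullback_surjective B hB) ?_ |>.symm
  intro χ
  rw [gammaChi, gammaChi, hone, hinv]
  congr 1
  · congr 1
    · congr 1
      simp only [hnorm]
      exact setAverage_cell_comp hτ hτ' A hA t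
        (F := fun x => ‖phi τ 1 x‖ ^ 2 * ‖phi τ χ x‖ ^ 2)
        (fun s hs x => by simp only [norm_phi_periodic τ _ s hs])
    · obtain ⟨c₀, hc₀, h₀⟩ := hphi 1
      obtain ⟨c₁, hc₁, h₁⟩ := hphi χ
      obtain ⟨c₂, hc₂, h₂⟩ := hphi χ⁻¹
      have hGG : ∀ x, G x ^ 2 * conj (G x) ^ 2 = 1 := fun x => by
        rw [← mul_pow, Complex.mul_conj, Complex.normSq_eq_norm_sq, hG]
        simp
      set P : ℂ → ℂ := fun x => phi τ 1 x ^ 2 * conj (phi τ χ x) * conj (phi τ χ⁻¹ x) with hP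
      -- The phase `G` occurs twice plain and twice conjugated, so it cancels pointwise; the
      -- constants survive only as a unimodular factor outside the integral.
      have hprod : ∀ x, phi τ' (pullback B hB 1) x ^ 2 * conj (phi τ' (pullback B hB χ) x) *
          conj (phi τ' (pullback B hB χ⁻¹) x) =
          (c₀ ^ 2 * conj c₁ * conj c₂) * κ (P (A x + t)) := fun x => by
        rw [h₀, h₁, h₂, hP]
        simp only [map_mul, map_pow, hκc]
        linear_combination (c₀ ^ 2 * conj c₁ * conj c₂ * κ (phi τ 1 (A x + t)) ^ 2 *
          conj (κ (phi τ χ (A x + t))) * conj (κ (phi τ χ⁻¹ (A x + t)))) * hGG x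
      simp only [hprod]
      have hav : ⨍ x in cell τ', P (A x + t) = ⨍ x in cell τ, P x :=
        setAverage_cell_comp hτ hτ' A hA t (phi_product_periodic τ χ)
      rw [← hav, setAverage_eq, setAverage_eq, norm_smul, norm_smul, integral_const_mul, norm_mul]
      simp only [norm_mul, norm_pow, RCLike.norm_conj, hc₀, hc₁, hc₂, one_pow, one_mul]
      congr 1
      rcases hκ with rfl | rfl
      · rfl
      · rw [integral_conj, RCLike.norm_conj]
  · simp only [hnorm]
    exact setAverage_cell_comp hτ hτ' A hA t (F := fun x => ‖phi τ 1 x‖ ^ 4)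
      (fun s hs x => by simp only [norm_phi_periodic τ _ s hs])

/-! ### The three symmetries and modular invariance -/

theorem exp_pi_mul_eq_of_even {a b : ℤ} (h : Even (a - b)) :
    Complex.exp (Real.pi * a * Complex.I) = Complex.exp (Real.pi * b * Complex.I) := by
  obtain ⟨k, hk⟩ := h
  obtain rfl : a = b + (k + k) := by omega
  rw [show (Real.pi : ℂ) * ((b + (k + k) : ℤ) : ℂ) * Complex.I =
    Real.pi * b * Complex.I + k * (2 * Real.pi * Complex.I) by push_cast; ring, Complex.exp_add,
    Complex.exp_int_mul_two_pi_mul_I, mul_one]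

theorem mem_lattice_iff_of_injective {τ τ' : ℂ} (A : ℂ → ℂ) (hA : Function.Injective A)
    {p q p' q' : ℤ → ℤ → ℤ}
    (h : ∀ m n, A (latticePoint τ' m n) = latticePoint τ (p m n) (q m n))
    (h' : ∀ m n, A (latticePoint τ' (p' m n) (q' m n)) = latticePoint τ m n) (s : ℂ) :
    s ∈ lattice τ' ↔ A s ∈ lattice τ := by
  constructor
  · rintro ⟨m, n, rfl⟩
    exact ⟨_, _, (h m n).symm⟩
  · rintro ⟨m, n, hs⟩
    exact ⟨p' m n, q' m n, hA (by rw [h', hs])⟩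

theorem latticePoint_add_int (τ : ℂ) (k m n : ℤ) :
    latticePoint (τ + k) m n = latticePoint τ (m + k * n) n := by
  simp only [latticePoint, latticeBasis₁, latticeBasis₂, Complex.add_im, Complex.intCast_im,
    add_zero]
  push_cast
  ring

theorem mem_lattice_add_int (τ : ℂ) (k : ℤ) (s : ℂ) : s ∈ lattice (τ + k) ↔ s ∈ lattice τ :=
  mem_lattice_iff_of_injective id Function.injective_id (p' := fun m n => m - k * n)
    (q' := fun _ n => n) (latticePoint_add_int τ k) (fun m n => by
      rw [id, latticePoint_add_int, sub_add_cancel]) s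

/-- Translation by `k ν₁ / 2` produces the sign `(-1)^(kn)`, because `ν₁ ∧ ν₂ = 2π`. -/
theorem gaugePhase_half_period {τ : ℂ} (hτ : 0 < τ.im) (k m n : ℤ) :
    gaugePhase (latticePoint (τ + k) m n) (k * latticeBasis₁ τ / 2) ^ 2 =
      Complex.exp (Real.pi * ((-(k * n) : ℤ) : ℂ) * Complex.I) := by
  rw [gaugePhase, ← Complex.exp_nat_mul]
  congr 1
  rw [latticePoint_add_int]
  simp only [latticePoint, latticeBasis₁, latticeBasis₂]
  have h1 := latticeScale_sq hτ
  set r := Real.sqrt (2 * Real.pi / τ.im)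
  have h2 : (r : ℂ) ^ 2 * τ.im = 2 * Real.pi := by exact_mod_cast h1
  have h3 := Complex.sub_conj τ
  simp only [map_add, map_mul, map_div₀, map_ofNat, map_intCast, Complex.conj_ofReal]
  push_cast at h3 ⊢
  linear_combination (-k * n * r ^ 2 / 4) * h3 - (k * n * Complex.I / 2) * h2

theorem exists_translated_solution {τ τ' : ℂ} (hτ : 0 < τ.im) {k : ℤ} (hk : τ' = τ + k)
    {χ : DualGroup τ} {χ' : DualGroup τ'}
    (hχ : ∀ m n, (χ' ⟨latticePoint τ' m n, m, n, rfl⟩ : ℂ) =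
      χ ⟨latticePoint τ (m + k * n) n, _, _, rfl⟩) {φ : ℂ → ℂ}
    (h : IsThetaSolution τ (multiplier τ χ) φ) :
    IsThetaSolution τ' (multiplier τ' χ') (fun x =>
      gaugePhase (-(k * latticeBasis₁ τ / 2)) x * φ (x + k * latticeBasis₁ τ / 2)) := by
  subst hk
  have hτ' : 0 < (τ + k).im := by simpa using hτ
  refine (h.translate hτ hτ' (latticePoint_add_int τ k) (mem_lattice_add_int τ k) _).congr_multiplier
    fun m n => ?_
  rw [gaugePhase_half_period hτ, multiplier, multiplier, hχ, mul_right_comm, ← Complex.exp_add]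
  congr 1
  -- Changing basis turns `mn` into `mn + kn²`, and the half-period shift subtracts `kn`; the
  -- discrepancy `kn(n - 1)` is even.
  have h1 := exp_pi_mul_eq_of_even (a := (m + k * n) * n + -(k * n)) (b := m * n) (by
    rw [show (m + k * n) * n + -(k * n) - m * n = k * (n * (n - 1)) by ring]
    exact (Int.even_mul_pred_self n).mul_left k)
  push_cast at h1 ⊢
  rw [mul_assoc (Real.pi : ℂ) m, ← h1]
  congr 1
  ring

theorem gamma_add_one {τ : ℂ} (hτ : 0 < τ.im) : gamma (τ + 1) = gamma τ := by
  have hlat : ∀ s, s ∈ lattice (τ + 1) ↔ s ∈ lattice τ := by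
    simpa using mem_lattice_add_int τ 1
  have hpt : ∀ m n, latticePoint (τ + 1) m n = latticePoint τ (m + 1 * n) n := by
    simpa using latticePoint_add_int τ 1
  have hτ' : 0 < (τ + 1).im := by simpa using hτ
  have hB : ∀ s, s ∈ lattice (τ + 1) ↔ AddEquiv.refl ℂ s ∈ lattice τ := hlat
  refine gamma_eq_of_transform hτ hτ' (AddEquiv.refl ℂ) hB (LinearIsometryEquiv.refl ℝ ℂ) hlat
    (((1 : ℤ) : ℂ) * latticeBasis₁ τ / 2) (gaugePhase (-(((1 : ℤ) : ℂ) * latticeBasis₁ τ / 2)))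
    (norm_gaugePhase _) (RingHom.id ℂ) (Or.inl rfl) (fun χ φ h => ?_) (fun χ φ h => ?_)
  · refine exists_translated_solution hτ (k := 1) (by simp) (fun m n => ?_) h
    exact congrArg _ (pullback_latticePoint _ hB χ (hpt m n))
  · refine ⟨_, exists_translated_solution hτ' (k := -1) (by simp) (fun m n => ?_) h⟩
    refine congrArg _ (pullback_latticePoint _ hB χ ?_).symm
    rw [AddEquiv.refl_apply, hpt]
    congr 1
    ring

theorem gamma_neg_inv {τ : ℂ} (hτ : 0 < τ.im) : gamma (-1 / τ) = gamma τ := by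
  have hτ0 : τ ≠ 0 := fun h => by simp [h] at hτ
  have hn : 0 < Complex.normSq τ := Complex.normSq_pos.2 hτ0
  have him : (-1 / τ).im = τ.im / Complex.normSq τ := by
    rw [neg_div, one_div, Complex.neg_im, Complex.inv_im]
    ring
  have hτ' : 0 < (-1 / τ).im := by
    rw [him]
    positivity
  have hscale : Real.sqrt (2 * Real.pi / (-1 / τ).im) = ‖τ‖ * Real.sqrt (2 * Real.pi / τ.im) := by
    rw [him, div_div_eq_mul_div, mul_comm, mul_div_assoc, Real.sqrt_mul hn.le,
      Complex.normSq_eq_norm_sq, Real.sqrt_sq (norm_nonneg _)]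
  have hnorm : (‖τ‖ : ℂ) ≠ 0 := by simpa using hτ0
  let u : Circle := ⟨τ / ‖τ‖, by simp [Submonoid.unitSphere, hτ0]⟩
  have hu : (u : ℂ) = τ / ‖τ‖ := rfl
  -- The new scale is `‖τ‖` times the old one, so rotation by `τ / ‖τ‖` sends the new basis to `ν₂,
  -- -ν₁`. The parity of `mn` is preserved.
  have hpt : ∀ m n : ℤ, (u : ℂ) * latticePoint (-1 / τ) m n = latticePoint τ (-n) m := by
    intro m n
    simp only [latticePoint, latticeBasis₁, latticeBasis₂, hscale, hu]
    push_cast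
    field_simp
    ring
  have hlat : ∀ s, s ∈ lattice (-1 / τ) ↔ (u : ℂ) * s ∈ lattice τ :=
    mem_lattice_iff_of_injective _ (mul_right_injective₀ u.coe_ne_zero) (p' := fun _ n => n)
      (q' := fun m _ => -m) hpt (fun m n => by rw [hpt, neg_neg])
  refine gamma_eq_of_transform hτ hτ' (rotation u).toLinearEquiv.toAddEquiv hlat (rotation u) hlat 0
    (fun _ => 1) (fun _ => by simp) (RingHom.id ℂ) (Or.inl rfl) (fun χ φ h => ?_) (fun χ φ h => ?_)
  · have h1 := (h.rotate hτ hτ' u hpt hlat).congr_multiplier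
      (μ' := multiplier _ (pullback (rotation u).toLinearEquiv.toAddEquiv hlat χ)) (fun m n => by
        rw [multiplier_pullback _ hlat χ (hpt m n), multiplier]
        congr 1
        have := exp_pi_mul_eq_of_even (a := -n * m) (b := m * n) ⟨-(n * m), by ring⟩
        push_cast at this ⊢
        simpa only [mul_assoc] using this)
    simpa [rotation_apply] using h1
  · have hpt' : ∀ m n : ℤ, ((u⁻¹ : Circle) : ℂ) * latticePoint τ m n =
        latticePoint (-1 / τ) n (-m) := fun m n => by
      rw [Circle.coe_inv, inv_mul_eq_iff_eq_mul₀ u.coe_ne_zero, hpt, neg_neg]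
    refine ⟨_, (h.rotate hτ' hτ u⁻¹ hpt' (fun s => ?_)).congr_multiplier fun m n => ?_⟩
    · rw [hlat, Circle.coe_inv, mul_inv_cancel_left₀ u.coe_ne_zero]
    · rw [multiplier_pullback (p := m) (q := n) _ hlat χ (by
        have := hpt n (-m)
        rwa [neg_neg] at this), multiplier]
      congr 1
      have := exp_pi_mul_eq_of_even (a := n * -m) (b := m * n) ⟨-(n * m), by ring⟩
      push_cast at this ⊢
      simpa only [mul_assoc] using this

theorem gamma_neg_conj {τ : ℂ} (hτ : 0 < τ.im) : gamma (-conj τ) = gamma τ := by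
  have hτ' : 0 < (-conj τ).im := by simpa using hτ
  have hpt : ∀ m n : ℤ, conj (latticePoint (-conj τ) m n) = latticePoint τ m (-n) := by
    intro m n
    simp [latticePoint, latticeBasis₁, latticeBasis₂]
  have hlat : ∀ s, s ∈ lattice (-conj τ) ↔ conj s ∈ lattice τ :=
    mem_lattice_iff_of_injective _ star_injective (p' := fun m _ => m)
      (q' := fun _ n => -n) hpt (fun m n => by rw [hpt, neg_neg])
  have hpt' : ∀ m n : ℤ, conj (latticePoint τ m n) = latticePoint (-conj τ) m (-n) := fun m n => by
    have := hpt m (-n)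
    rw [neg_neg] at this
    rw [← this, Complex.conj_conj]
  -- Points move by `conj`, but conjugating values also inverts the character; the extra minus sign
  -- in `B` absorbs that inversion.
  let B : ℂ ≃+ ℂ := (starRingAut : ℂ ≃+* ℂ).toAddEquiv.trans (AddEquiv.neg ℂ)
  have hBapp : ∀ s, B s = -conj s := fun s => rfl
  have hB : ∀ s, s ∈ lattice (-conj τ) ↔ B s ∈ lattice τ := fun s => by
    rw [hBapp, neg_mem_iff, hlat]
  have hBpt : ∀ m n : ℤ, B (latticePoint (-conj τ) m n) = latticePoint τ (-m) n := fun m n => by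
    rw [hBapp, hpt]
    simp only [latticePoint]
    push_cast
    ring
  have hmult : ∀ (χ : DualGroup τ) (m n : ℤ),
      multiplier _ (pullback B hB χ) m n = conj (multiplier τ χ m (-n)) := fun χ m n => by
    rw [multiplier_pullback _ hB χ (hBpt m n), multiplier, map_mul, ← Complex.exp_conj]
    congr 1
    · congr 1
      simp
    · rw [← Circle.coe_inv_eq_conj, ← AddChar.inv_apply', AddChar.inv_apply]
      congr 3
      simp only [latticePoint]
      push_cast
      ring
  refine gamma_eq_of_transform hτ hτ' B hB Complex.conjLIE (by simpa using hlat) 0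
    (fun _ => 1) (fun _ => by simp) (starRingEnd ℂ) (Or.inr rfl) (fun χ φ h => ?_)
    (fun χ φ h => ?_)
  · have h1 := (h.conj hτ hτ' hpt hlat).congr_multiplier
      (μ' := multiplier _ (pullback B hB χ)) (fun m n => (hmult χ m n).symm)
    simpa using h1
  · refine ⟨_, (h.conj hτ' hτ hpt' (fun s => ?_)).congr_multiplier fun m n => ?_⟩
    · rw [hlat, Complex.conj_conj]
    · rw [hmult, Complex.conj_conj, neg_neg]

theorem gamma_smul (g : Matrix.SpecialLinearGroup (Fin 2) ℤ) (τ : UpperHalfPlane) :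
    gamma ((g • τ : UpperHalfPlane) : ℂ) = gamma (τ : ℂ) := by
  have hg : g ∈ Subgroup.closure {ModularGroup.S, ModularGroup.T} := by
    simp [SpecialLinearGroup.SL2Z_generators]
  induction hg using Subgroup.closure_induction generalizing τ with
  | mem g hg =>
    rcases hg with rfl | rfl
    · rw [UpperHalfPlane.modular_S_smul, UpperHalfPlane.coe_mk, ← gamma_neg_inv τ.im_pos]
      congr 1
      rw [inv_neg, neg_div, one_div]
    · rw [UpperHalfPlane.modular_T_smul, UpperHalfPlane.coe_vadd, ← gamma_add_one τ.im_pos]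
      congr 1
      push_cast
      ring
  | one => rw [one_smul]
  | mul x y _ _ hx hy => rw [mul_smul, hx, hy]
  | inv x _ hx => rw [← hx, smul_inv_smul]

/-! ### Critical points at the elliptic points -/

/-- The derivative at a fixed point of a holomorphic symmetry is invariant under the multiplier
of that symmetry. -/
theorem fderiv_mul_eq_of_invariant {F : ℂ → ℝ} {σ : ℂ → ℂ} {τ a : ℂ} (hF : DifferentiableAt ℝ F τ)
    (hσ : HasDerivAt σ a τ) (hfix : σ τ = τ) (hinv : ∀ᶠ z in nhds τ, F (σ z) = F z) (v : ℂ) :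
    fderiv ℝ F τ (a * v) = fderiv ℝ F τ v := by
  have h1 : HasFDerivAt F (fderiv ℝ F τ) (σ τ) := by
    rw [hfix]
    exact hF.hasFDerivAt
  have h2 := h1.comp τ (hσ.hasFDerivAt.restrictScalars ℝ)
  have h3 := (h2.congr_of_eventuallyEq (hinv.mono fun z hz => hz.symm)).unique hF.hasFDerivAt
  have := congrArg (fun L : ℂ →L[ℝ] ℝ => L v) h3
  simpa [mul_comm] using this

theorem eventually_im_pos {τ : ℂ} (hτ : 0 < τ.im) : ∀ᶠ z in nhds τ, 0 < z.im :=
  Complex.continuous_im.continuousAt.eventually (lt_mem_nhds hτ)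

/-- The map `z ↦ -1/z` fixes `I` with derivative `-1`, so the differential equals its own negative.
-/
theorem hasFDerivAt_gamma_I (h : DifferentiableAt ℝ gamma Complex.I) :
    HasFDerivAt gamma (0 : ℂ →L[ℝ] ℝ) Complex.I := by
  have hd : HasDerivAt (fun z : ℂ => -1 / z) (-1) Complex.I := by
    simp only [div_eq_mul_inv]
    refine ((hasDerivAt_inv Complex.I_ne_zero).const_mul (-1)).congr_deriv ?_
    rw [Complex.I_sq]
    norm_num
  have key := fderiv_mul_eq_of_invariant h hd
    (by rw [div_eq_iff Complex.I_ne_zero, Complex.I_mul_I])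
    ((eventually_im_pos (by simp)).mono fun z hz => gamma_neg_inv hz)
  have h0 : fderiv ℝ gamma Complex.I = 0 := by
    ext1 v
    have := key v
    rw [neg_one_mul, map_neg] at this
    simp only [zero_apply]
    linarith
  rw [← h0]
  exact h.hasFDerivAt

/-- The map `z ↦ 1 - 1/z` fixes `ρ` with derivative `1/ρ² = -ρ`, a primitive cube root of unity. The
differential takes equal values at `v`, `-ρv` and `ρ²v`, whose sum is zero. -/
theorem hasFDerivAt_gamma_of_sq_eq {ρ : ℂ} (hρ : ρ ^ 2 = ρ - 1) (him : 0 < ρ.im)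
    (h : DifferentiableAt ℝ gamma ρ) : HasFDerivAt gamma (0 : ℂ →L[ℝ] ℝ) ρ := by
  have hρ0 : ρ ≠ 0 := fun h0 => by simp [h0] at him
  have hd : HasDerivAt (fun z : ℂ => -1 / z + 1) (-ρ) ρ := by
    simp only [div_eq_mul_inv]
    refine (((hasDerivAt_inv hρ0).const_mul (-1)).add_const 1).congr_deriv ?_
    field_simp
    linear_combination (ρ + 1) * hρ
  have key := fderiv_mul_eq_of_invariant h hd
    (by
      field_simp
      linear_combination -hρ)
    ((eventually_im_pos him).mono fun z hz => by
      have hz' : 0 < (-1 / z).im := by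
        have : 0 < Complex.normSq z := Complex.normSq_pos.2 fun h0 => by simp [h0] at hz
        rw [neg_div, one_div, Complex.neg_im, Complex.inv_im, neg_div, neg_neg]
        positivity
      rw [gamma_add_one hz', gamma_neg_inv hz])
  have h0 : fderiv ℝ gamma ρ = 0 := by
    ext1 v
    have h1 := key v
    have h2 := key (-ρ * v)
    have h3 : fderiv ℝ gamma ρ (-ρ * (-ρ * v)) + fderiv ℝ gamma ρ (-ρ * v)
        + fderiv ℝ gamma ρ v = 0 := by
      rw [← map_add, ← map_add, show -ρ * (-ρ * v) + -ρ * v + v = 0 by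
        linear_combination v * hρ, map_zero]
    simp only [zero_apply]
    linarith
  rw [← h0]
  exact h.hasFDerivAt

theorem exp_I_mul_pi_div_three_sq :
    Complex.exp (Complex.I * Real.pi / 3) ^ 2 = Complex.exp (Complex.I * Real.pi / 3) - 1 ∧
      0 < (Complex.exp (Complex.I * Real.pi / 3)).im := by
  have h : Complex.exp (Complex.I * Real.pi / 3) = (1 / 2 : ℝ) + (Real.sqrt 3 / 2 : ℝ) * Complex.I := by
    rw [show Complex.I * Real.pi / 3 = ((Real.pi / 3 : ℝ) : ℂ) * Complex.I by push_cast; ring,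
      Complex.exp_mul_I, ← Complex.ofReal_cos, ← Complex.ofReal_sin, Real.cos_pi_div_three,
      Real.sin_pi_div_three]
  rw [h]
  constructor
  · have h3 : ((Real.sqrt 3 : ℝ) : ℂ) ^ 2 = 3 := by
      exact_mod_cast congrArg ((↑) : ℝ → ℂ) (Real.sq_sqrt (show (0 : ℝ) ≤ 3 by norm_num))
    push_cast
    linear_combination (Real.sqrt 3 : ℂ) ^ 2 / 4 * Complex.I_sq - h3 / 4
  · simp

end

end Abrikosov

theorem proposition1p3 :
    (∀ τ : ℂ, 0 < τ.im →
      Abrikosov.gamma (τ + 1) = Abrikosov.gamma τ ∧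
      Abrikosov.gamma (-1 / τ) = Abrikosov.gamma τ ∧
      Abrikosov.gamma (-(starRingEnd ℂ) τ) = Abrikosov.gamma τ) ∧
    (∀ (g : Matrix.SpecialLinearGroup (Fin 2) ℤ) (τ : UpperHalfPlane),
      Abrikosov.gamma ((g • τ : UpperHalfPlane) : ℂ) = Abrikosov.gamma (τ : ℂ)) ∧
    (∀ τ : ℂ,
      τ = Complex.exp (Complex.I * Real.pi / 2) ∨ τ = Complex.exp (Complex.I * Real.pi / 3) →
      DifferentiableAt ℝ Abrikosov.gamma τ →
      HasFDerivAt Abrikosov.gamma (0 : ℂ →L[ℝ] ℝ) τ) := by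
  refine ⟨fun τ hτ => ⟨Abrikosov.gamma_add_one hτ, Abrikosov.gamma_neg_inv hτ,
    Abrikosov.gamma_neg_conj hτ⟩, Abrikosov.gamma_smul, ?_⟩
  rintro τ (hτ | hτ) h
  · have : τ = Complex.I := by
      rw [hτ, show Complex.I * Real.pi / 2 = Real.pi / 2 * Complex.I by ring,
        Complex.exp_pi_div_two_mul_I]
    subst this
    exact Abrikosov.hasFDerivAt_gamma_I h
  · rw [hτ] at h ⊢
    exact Abrikosov.hasFDerivAt_gamma_of_sq_eq Abrikosov.exp_I_mul_pi_div_three_sq.1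
      Abrikosov.exp_I_mul_pi_div_three_sq.2 h
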